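/- **Theorem 3 (Top-2 sample complexity).** Let $\Theta$ be a finite set of $J=|\Theta|\ge 2$ hypotheses with true hypothesis $\theta^*\in\Theta$, let $[n]$ be the set of arms, let $\eta>0$, and for $i\in[n]$, $\theta\in\Theta$ let $\nu_i(\cdot;\theta)$ be a probability law on $[-\sqrt\eta/2,\sqrt\eta/2]$ with mean $\mu_i(\theta)$. Assume $\mu_i(\theta)\ne\mu_i(\theta^*)$ for all $i$ and all $\theta\ne\theta^*$, and put $\eta_0=\min_{i}\min_{\theta\neq\theta^*}(\mu_i(\theta)-\mu_i(\theta^*))^2>0$. Let $\delta\in(0,1]$. In round $t=1,2,\dots$ an arm $I_t$ is pulled and a reward $Y_t$ is observed which, given the past and $I_t=i$, has law $\nu_i(\cdot;\theta^*)$. Let $L_t(\theta)=\sum_{s=1}^t(Y_s-\mu_{I_s}(\theta))^2$, let $\hat\theta(t)$ be a minimizer of $L_t$ over $\Theta$ and $\tilde\theta(t)$ a minimizer of $L_t$ over $\Theta\setminus\{\hat\theta(t)\}$ (ties broken in any, possibly random, way that does not look into the future). The first arm is random with any law. The Top-2 rule draws $I_{t+1}$, given the past, from the uniform distribution $u_{\hat\theta(t),\tilde\theta(t)}$,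 where $u_{\theta,\theta'}$ is the uniform probability mass function on the set of arms $i$ that maximize $(\mu_i(\theta)-\mu_i(\theta'))^2$. Let $\tau_\delta$ be the first round $t\ge2$ with $L_t(\theta')-L_t(\hat\theta(t))>\log(J/\delta)$ for all $\theta'\neq\hat\theta(t)$. Define $$D_0'=\min_{\theta\ne\theta^*,\ \theta'\neq\theta^*}\sum_{i=1}^n u_{\theta^*,\theta}(i)(\mu_i(\theta')-\mu_i(\theta^*))^2,$$ $$D_1'=\min_{\theta\neq\tilde\theta,\ \theta'\neq\theta^*}\sum_{i=1}^n u_{\theta,\tilde\theta}(i)(\mu_i(\theta')-\mu_i(\theta^*))^2,\qquad D_1''=\min_{\theta\neq\theta',\ \theta'\neq\theta^*}\sum_{i=1}^n u_{\theta,\theta'}(i)(\mu_i(\theta')-\mu_i(\theta^*))^2 .$$ There are a universal constant $K>0$ and a function $C_*(\eta_0,\eta)>1$ of $\eta_0$ and $\eta$ alone such that in every such setting: (1) if $D_1'>0$ then, with $C=44+\eta^2/\eta_0^2$, $$\mathbb E[\tau_\delta]\le K\left(\frac{\eta\log C\,\log J}{D_1'}+\frac{\log(J/\delta)}{D_0'}+J\,C^{1/\eta}\,\delta^{D_0'/\eta^2}\right);$$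 (2) if $D_1''>0$ then, with $C=C_*(\eta_0,\eta)$, $$\mathbb E[\tau_\delta]\le K\left(\frac{\eta\log C\,\log J}{D_1''}+\frac{\log(J/\delta)}{D_0'}+J\,C^{1/\eta}\,\delta^{D_0'/\eta^2}\right).$$ -/

import Mathlib

open MeasureTheory ProbabilityTheory
open scoped ENNReal

namespace TopTwo

noncomputable section

/-- The mean reward of arm `i` under hypothesis `θ`, where `ν i θ` is the reward law. -/
def mean {n : ℕ} {Θ : Type*} (ν : Fin n → Θ → Measure ℝ) (i : Fin n) (θ : Θ) : ℝ :=
  ∫ y, y ∂(ν i θ)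

open Classical in
/-- The arms that best separate `θ` from `θ'`: the maximizers of `i ↦ (m i θ - m i θ')²`. -/
def bestArms {n : ℕ} {Θ : Type*} (m : Fin n → Θ → ℝ) (θ θ' : Θ) : Finset (Fin n) :=
  Finset.univ.filter fun i => ∀ j, (m j θ - m j θ') ^ 2 ≤ (m i θ - m i θ') ^ 2

open Classical in
/-- The uniform probability mass function on `bestArms m θ θ'`. -/
def unif {n : ℕ} {Θ : Type*} (m : Fin n → Θ → ℝ) (θ θ' : Θ) (i : Fin n) : ℝ :=
  if i ∈ bestArms m θ θ' then 1 / ((bestArms m θ θ').card : ℝ) else 0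

/-- The mean squared separation of `θ'` from `θs` when the arm is drawn from the uniform
distribution on the best arms for the pair `(a, b)`. -/
def sep {n : ℕ} {Θ : Type*} (m : Fin n → Θ → ℝ) (θs a b θ' : Θ) : ℝ :=
  ∑ i, unif m a b i * (m i θ' - m i θs) ^ 2

/-- `D₀'`: minimum over `θ ≠ θs` and `θ' ≠ θs` of the separation of `θ'` from `θs`
under the sampling distribution of the pair `(θs, θ)`. -/
def D0 {n : ℕ} {Θ : Type*} (m : Fin n → Θ → ℝ) (θs : Θ) : ℝ :=
  ⨅ p : {θ : Θ // θ ≠ θs} × {θ' : Θ // θ' ≠ θs}, sep m θs θs p.1 p.2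

/-- `D₁'`: minimum over all pairs `a ≠ b` that the most likely and the second most likely
hypothesis can form, and over all `θ' ≠ θs`, of the separation of `θ'` from `θs` under the
sampling distribution of the pair `(a, b)`. -/
def D1 {n : ℕ} {Θ : Type*} (m : Fin n → Θ → ℝ) (θs : Θ) : ℝ :=
  ⨅ p : {q : Θ × Θ // q.1 ≠ q.2} × {θ' : Θ // θ' ≠ θs}, sep m θs p.1.1.1 p.1.1.2 p.2

/-- The two-index variant of `D1`: the hypothesis that is compared with `θs` is
the second member of the sampled pair, `θ ≠ θ'` and `θ' ≠ θs`. -/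
def D1pair {n : ℕ} {Θ : Type*} (m : Fin n → Θ → ℝ) (θs : Θ) : ℝ :=
  ⨅ p : {q : Θ × Θ // q.1 ≠ q.2 ∧ q.2 ≠ θs}, sep m θs p.1.1 p.1.2 p.1.2

/-- `η₀`: the smallest squared difference, over all arms, between the mean under the true
hypothesis and the mean under another hypothesis. -/
def eta0 {n : ℕ} {Θ : Type*} (m : Fin n → Θ → ℝ) (θs : Θ) : ℝ :=
  ⨅ p : Fin n × {θ : Θ // θ ≠ θs}, (m p.1 p.2 - m p.1 θs) ^ 2

/-- The sum of squared errors of hypothesis `θ` after `t` rounds. The rounds are `1, 2, 3, …`. -/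
def sqErr {n : ℕ} {Θ Ω : Type*} (m : Fin n → Θ → ℝ) (I : ℕ → Ω → Fin n) (Y : ℕ → Ω → ℝ)
    (t : ℕ) (θ : Θ) (ω : Ω) : ℝ :=
  ∑ s ∈ Finset.Icc 1 t, (Y s ω - m (I s ω) θ) ^ 2

/-- `I t` and `Y t` are the arm and the reward of round `t ≥ 1`, `best t` and `second t` the most
likely and second most likely hypothesis after round `t`, in a run of the Top-2 rule when `θs` is
the true hypothesis. The filtration `ℱ` is the information after each round; it may contain
the extra randomness used to break ties, which is otherwise unrestricted, and the law of
the first arm is arbitrary. (The values at index `0` of the four processes are not used.) -/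
structure IsRun {n : ℕ} {Θ Ω : Type*} {mΩ : MeasurableSpace Ω} (ν : Fin n → Θ → Measure ℝ)
    (θs : Θ) (P : Measure Ω) (ℱ : Filtration ℕ mΩ) (I : ℕ → Ω → Fin n) (Y : ℕ → Ω → ℝ)
    (best second : ℕ → Ω → Θ) : Prop where
  arm_meas : ∀ t, 1 ≤ t → ∀ i, MeasurableSet[ℱ t] {ω | I t ω = i}
  reward_meas : ∀ t, 1 ≤ t → Measurable[ℱ t] (Y t)
  best_meas : ∀ t, 1 ≤ t → ∀ θ, MeasurableSet[ℱ t] {ω | best t ω = θ}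
  second_meas : ∀ t, 1 ≤ t → ∀ θ, MeasurableSet[ℱ t] {ω | second t ω = θ}
  /-- The most likely hypothesis minimizes the sum of squared errors. -/
  best_min : ∀ t, 1 ≤ t → ∀ ω θ,
    sqErr (mean ν) I Y t (best t ω) ω ≤ sqErr (mean ν) I Y t θ ω
  second_ne : ∀ t, 1 ≤ t → ∀ ω, second t ω ≠ best t ω
  /-- The second most likely one minimizes it among the other hypotheses. -/
  second_min : ∀ t, 1 ≤ t → ∀ ω θ, θ ≠ best t ω →
    sqErr (mean ν) I Y t (second t ω) ω ≤ sqErr (mean ν) I Y t θ ω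
  /-- Given the past, the next arm is uniform on the arms that best separate the two. -/
  arm_law : ∀ t, 1 ≤ t → ∀ i,
    P⟦{ω | I (t + 1) ω = i} | ℱ t⟧ =ᵐ[P]
      fun ω => unif (mean ν) (best t ω) (second t ω) i
  /-- Given the past and that arm `i` is pulled, the reward has law `ν i θs`. -/
  reward_law : ∀ t i, ∀ B : Set ℝ, MeasurableSet B →
    P⟦{ω | I (t + 1) ω = i ∧ Y (t + 1) ω ∈ B} | ℱ t⟧ =ᵐ[P]
      fun ω => (ν i θs).real B * (P⟦{ω | I (t + 1) ω = i} | ℱ t⟧) ω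

/-- The stopping time: the first round `t ≥ 2` at which the sum of squared errors of every
hypothesis other than `best t` exceeds that of `best t` by more than the threshold `β`
(`⊤` if there is none). -/
def stopTime {n : ℕ} {Θ Ω : Type*} (m : Fin n → Θ → ℝ) (I : ℕ → Ω → Fin n) (Y : ℕ → Ω → ℝ)
    (best : ℕ → Ω → Θ) (β : ℝ) (ω : Ω) : ℕ∞ :=
  ⨅ t : {t : ℕ // 2 ≤ t ∧
    ∀ θ', θ' ≠ best t ω → β < sqErr m I Y t θ' ω - sqErr m I Y t (best t ω) ω}, ((t : ℕ) : ℕ∞)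

/-- The three-term expression
`η log C log J / D₁ + log (J / δ) / D₀ + J C ^ (1 / η) δ ^ (D₀ / η²)`. -/
def bound (η C J δ d0 d1 : ℝ) : ℝ :=
  η * Real.log C * Real.log J / d1 + Real.log (J / δ) / d0 + J * C ^ (1 / η) * δ ^ (d0 / η ^ 2)

end

end TopTwo

/-! Write the excess of a wrong hypothesis `θ` for its squared error minus that of `θs`. In one
round with arm mean difference `d`, the excess grows by `d ^ 2` plus noise that is linear in the
centred reward. Hoeffding's lemma then bounds the conditional mean of `exp (-increment / η)` by `exp
(-d ^ 2 / (2 * η))`. Averaging over the drawn arm leaves at most `exp (-sep / (4 * η))`. Hence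
`compensated` has mean at most one (`lintegral_compensated_le_one`), and Markov's inequality makes a
small excess after much separation exponentially unlikely (`measure_sqErr_sub_le_and_le_sum`).

This is used twice. Every draw separates at least by `D1`, so a wrong leader after round `t` has
probability of order `J * exp (-D1 * t / (4 * η))`. If `θs` leads throughout rounds `k, ..., 2 * k -
1`, each of those rounds sets up a draw with separation at least `D0`, and the threshold is probably
passed by round `2 * k` (`measure_running_le`). Summing over `k` costs `log A / a` per tail `A * exp
(-a * k)`, which gives the first two terms of `bound`; the third is only nonnegative slack.

For the second claim, `D1` is at least `η₀` and `D1pair` at most `η`, so exchanging them costs a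
factor `η / η₀`, which an exponent in the constant absorbs. -/

namespace TopTwo

/-! ### Conditioning on the past -/

/-- Restricting to an event and integrating a function of the past is the same as weighting that
function by the conditional probability of the event. -/
theorem setLIntegral_eq_lintegral_mul_condProb {Ω : Type*} {m mΩ : MeasurableSpace Ω}
    (hm : m ≤ mΩ) {P : Measure Ω} [IsProbabilityMeasure P] {E : Set Ω} (hE : MeasurableSet E)
    {u : Ω → ℝ} (hu : P⟦E | m⟧ =ᵐ[P] u) (hum : Measurable[m] u) (hu0 : ∀ ω, 0 ≤ u ω)
    {G : Ω → ℝ≥0∞} (hG : Measurable[m] G) :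
    ∫⁻ ω in E, G ω ∂P = ∫⁻ ω, G ω * ENNReal.ofReal (u ω) ∂P := by
  have hint : Integrable u P := integrable_condExp.congr hu
  have hum' : Measurable[m] fun ω => ENNReal.ofReal (u ω) := hum.ennreal_ofReal
  -- On the past, the restricted law has the conditional probability as its density.
  have key : (P.restrict E).trim hm = (P.trim hm).withDensity fun ω => ENNReal.ofReal (u ω) := by
    refine @Measure.ext _ m _ _ fun A hA => ?_
    rw [trim_measurableSet_eq hm hA, Measure.restrict_apply (hm A hA), withDensity_apply _ hA,
      restrict_trim hm P hA, lintegral_trim hm hum',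
      ← ofReal_integral_eq_lintegral_ofReal hint.integrableOn (Filter.Eventually.of_forall hu0),
      ← setIntegral_congr_ae (hm A hA) (hu.mono fun ω h _ => h),
      setIntegral_condExp hm ((integrable_const (1 : ℝ)).indicator hE) hA,
      setIntegral_indicator hE]
    simp
  rw [← lintegral_trim hm hG, key, lintegral_withDensity_eq_lintegral_mul _ hum' hG,
    lintegral_trim hm (hum'.mul hG)]
  simp only [Pi.mul_apply, mul_comm]

/-- A factorization of expectations for a variable that is independent of a `σ`-algebra under a
finite measure. -/
theorem lintegral_mul_comp_of_forall_measure_inter {Ω α : Type*} {m mΩ : MeasurableSpace Ω}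
    [MeasurableSpace α] (hm : m ≤ mΩ) {Q : Measure Ω} [IsFiniteMeasure Q] {ν : Measure α}
    [IsFiniteMeasure ν] {Y : Ω → α} (hY : Measurable Y)
    (h : ∀ A, MeasurableSet[m] A → ∀ B, MeasurableSet B → Q (A ∩ Y ⁻¹' B) = Q A * ν B)
    {G : Ω → ℝ≥0∞} (hG : Measurable[m] G) {φ : α → ℝ≥0∞} (hφ : Measurable φ) :
    ∫⁻ ω, G ω * φ (Y ω) ∂Q = (∫⁻ ω, G ω ∂Q) * ∫⁻ y, φ y ∂ν := by
  have hpair : @Measurable Ω (Ω × α) mΩ (@Prod.instMeasurableSpace _ _ m _) fun ω => (ω, Y ω) :=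
    Measurable.prodMk (measurable_id'' hm) hY
  -- The hypothesis on rectangles identifies the joint law of past and `Y` as a product, so Tonelli
  -- applies.
  have key : @Measure.prod _ _ m _ (Q.trim hm) ν =
      @Measure.map _ _ mΩ (@Prod.instMeasurableSpace _ _ m _) (fun ω => (ω, Y ω)) Q := by
    refine @Measure.prod_eq _ _ m _ _ _ _ _ _ fun A B hA hB => ?_
    rw [Measure.map_apply hpair (@MeasurableSet.prod _ _ m _ _ _ hA hB),
      trim_measurableSet_eq hm hA, ← h A hA B hB]
    rfl
  have hG' : @AEMeasurable _ _ _ m G (Q.trim hm) := hG.aemeasurable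
  have h1 := @lintegral_prod_mul _ _ m _ (Q.trim hm) ν _ _ _ hG' hφ.aemeasurable
  have hprod : @Measurable (Ω × α) ℝ≥0∞ (@Prod.instMeasurableSpace _ _ m _) _
      fun z => G z.1 * φ z.2 :=
    (hG.comp (@measurable_fst _ _ m _)).mul (hφ.comp (@measurable_snd _ _ m _))
  have h2 := @lintegral_map _ _ mΩ (@Prod.instMeasurableSpace _ _ m _) Q _ _ hprod hpair
  rw [key, h2, lintegral_trim hm hG] at h1
  exact h1

/-! ### Exponential inequalities for bounded rewards -/

/-- Hoeffding's lemma for the difference of two squared errors, one of them centred at the mean. -/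
theorem lintegral_exp_sq_sub_sq_le {η : ℝ} (hη : 0 < η) {ν : Measure ℝ} [IsProbabilityMeasure ν]
    (hν : ∀ᵐ y ∂ν, y ∈ Set.Icc (-(√η / 2)) (√η / 2)) (a : ℝ) :
    ∫⁻ y, ENNReal.ofReal (Real.exp (-((y - a) ^ 2 - (y - ∫ x, x ∂ν) ^ 2) / η)) ∂ν ≤
      ENNReal.ofReal (Real.exp (-(a - ∫ x, x ∂ν) ^ 2 / (2 * η))) := by
  set b := ∫ x, x ∂ν with hb
  have hs := hasSubgaussianMGF_of_mem_Icc (X := fun y : ℝ => y) aemeasurable_id hν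
  have hmgf := hs.mgf_le (2 * (a - b) / η)
  have hi := hs.integrable_exp_mul (2 * (a - b) / η)
  rw [mgf] at hmgf
  simp only [← hb] at hmgf hi
  -- An interval of length `√η` has variance proxy `(√η / 2) ^ 2`.
  have hc : (((‖√η / 2 - -(√η / 2)‖₊ / 2) ^ 2 : NNReal) : ℝ) = η / 4 := by
    rw [show √η / 2 - -(√η / 2) = √η by ring]
    push_cast
    rw [Real.norm_eq_abs, div_pow, sq_abs, Real.sq_sqrt hη.le]
    norm_num
  rw [hc] at hmgf
  have hfun : ∀ y : ℝ, Real.exp (-((y - a) ^ 2 - (y - b) ^ 2) / η) =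
      Real.exp (-(a - b) ^ 2 / η) * Real.exp (2 * (a - b) / η * (y - b)) := fun y => by
    rw [← Real.exp_add]; congr 1; field_simp; ring
  simp_rw [hfun]
  rw [← ofReal_integral_eq_lintegral_ofReal (hi.const_mul _)
    (Filter.Eventually.of_forall fun y => by positivity), integral_const_mul]
  refine ENNReal.ofReal_le_ofReal ?_
  calc _ ≤ Real.exp (-(a - b) ^ 2 / η) * Real.exp (η / 4 * (2 * (a - b) / η) ^ 2 / 2) := by gcongr
    _ = _ := by rw [← Real.exp_add]; congr 1; field_simp; ring

/-- The mean of a law on a symmetric interval lies in the interval. -/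
theorem abs_integral_id_le {c : ℝ} {ν : Measure ℝ} [IsProbabilityMeasure ν]
    (hν : ∀ᵐ y ∂ν, y ∈ Set.Icc (-c) c) : |∫ y, y ∂ν| ≤ c := by
  have := norm_integral_le_of_norm_le_const (μ := ν) (f := fun y => y)
    (hν.mono fun y hy => abs_le.2 ⟨hy.1, hy.2⟩)
  simpa using this

theorem sq_mean_sub_mean_le {n : ℕ} {Θ : Type*} {ν : Fin n → Θ → Measure ℝ} {η : ℝ} (hη : 0 < η)
    [∀ i θ, IsProbabilityMeasure (ν i θ)]
    (hν : ∀ i θ, ∀ᵐ y ∂(ν i θ), y ∈ Set.Icc (-(√η / 2)) (√η / 2)) (i : Fin n) (θ θ' : Θ) :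
    (mean ν i θ - mean ν i θ') ^ 2 ≤ η := by
  have h1 := abs_le.1 (abs_integral_id_le (hν i θ))
  have h2 := abs_le.1 (abs_integral_id_le (hν i θ'))
  rw [← Real.sq_sqrt hη.le]
  refine sq_le_sq' ?_ ?_ <;> simp only [mean] <;> linarith [h1.1, h1.2, h2.1, h2.2]

/-- The bound follows from `exp a ≥ 1 + a` and `(1 + a) * (1 - a / 2) ≥ 1` on the unit interval.
Being linear in `a`, it can be averaged over arms. -/
theorem exp_neg_le {a : ℝ} (ha : 0 ≤ a) (ha1 : a ≤ 1) : Real.exp (-a) ≤ 1 - a / 2 := by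
  rw [Real.exp_neg, inv_le_comm₀ (Real.exp_pos _) (by linarith)]
  refine le_trans ?_ (Real.add_one_le_exp _)
  rw [inv_le_iff_one_le_mul₀ (by linarith)]
  nlinarith

/-! ### The sampling distribution and its separations -/

section Unif

variable {n : ℕ} {Θ : Type*} (m : Fin n → Θ → ℝ) (θ θ' : Θ)

theorem unif_nonneg (i : Fin n) : 0 ≤ unif m θ θ' i := by
  unfold unif; split_ifs <;> positivity

theorem bestArms_nonempty [NeZero n] : (bestArms m θ θ').Nonempty := by
  obtain ⟨i, -, hi⟩ := Finset.exists_max_image Finset.univ (fun i => (m i θ - m i θ') ^ 2)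
    ⟨(0 : Fin n), Finset.mem_univ _⟩
  exact ⟨i, by simpa [bestArms] using hi⟩

theorem sum_unif [NeZero n] : ∑ i, unif m θ θ' i = 1 := by
  have h : ((bestArms m θ θ').card : ℝ) ≠ 0 := by
    exact_mod_cast (Finset.card_pos.2 (bestArms_nonempty m θ θ')).ne'
  simp [unif, Finset.sum_ite_mem, h]

/-- Exponential moments of a squared separation under the sampling distribution. -/
theorem sum_unif_mul_exp_le [NeZero n] {η : ℝ} (hη : 0 < η) (θs θ'' : Θ)
    (hm : ∀ i, (m i θ'' - m i θs) ^ 2 ≤ η) :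
    ∑ i, unif m θ θ' i * Real.exp (-(m i θ'' - m i θs) ^ 2 / (2 * η)) ≤
      Real.exp (-(sep m θs θ θ' θ'' / (4 * η))) := by
  have h : ∀ x : ℝ, 0 ≤ x → x ≤ η → Real.exp (-x / (2 * η)) ≤ 1 - x / (4 * η) := by
    intro x hx0 hx
    convert exp_neg_le (a := x / (2 * η)) (by positivity)
      (by rw [div_le_one (by positivity)]; linarith) using 2
    · ring
    · field_simp; ring
  calc _ ≤ ∑ i, unif m θ θ' i * (1 - (m i θ'' - m i θs) ^ 2 / (4 * η)) :=
        Finset.sum_le_sum fun i _ =>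
          mul_le_mul_of_nonneg_left (h _ (sq_nonneg _) (hm i)) (unif_nonneg m θ θ' i)
    _ = -(sep m θs θ θ' θ'' / (4 * η)) + 1 := by
        simp_rw [mul_sub, mul_one, Finset.sum_sub_distrib, sum_unif, sep, Finset.sum_div,
          mul_div_assoc]
        ring
    _ ≤ _ := Real.add_one_le_exp _

theorem sep_nonneg (θs θ'' : Θ) : 0 ≤ sep m θs θ θ' θ'' :=
  Finset.sum_nonneg fun i _ => mul_nonneg (unif_nonneg m θ θ' i) (sq_nonneg _)

theorem sep_le [NeZero n] {c : ℝ} (θs θ'' : Θ) (h : ∀ i, (m i θ'' - m i θs) ^ 2 ≤ c) :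
    sep m θs θ θ' θ'' ≤ c := by
  calc _ ≤ ∑ i, unif m θ θ' i * c :=
        Finset.sum_le_sum fun i _ => mul_le_mul_of_nonneg_left (h i) (unif_nonneg m θ θ' i)
    _ = c := by rw [← Finset.sum_mul, sum_unif, one_mul]

theorem le_sep [NeZero n] {c : ℝ} (θs θ'' : Θ) (h : ∀ i, c ≤ (m i θ'' - m i θs) ^ 2) :
    c ≤ sep m θs θ θ' θ'' := by
  calc c = ∑ i, unif m θ θ' i * c := by rw [← Finset.sum_mul, sum_unif, one_mul]
    _ ≤ _ := Finset.sum_le_sum fun i _ => mul_le_mul_of_nonneg_left (h i) (unif_nonneg m θ θ' i)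

end Unif

/-! ### Comparison of the minimal separations -/

section Minima

variable {n : ℕ} {Θ : Type*} [Fintype Θ] (m : Fin n → Θ → ℝ) (θs : Θ)

theorem D0_le_sep {θ θ' : Θ} (hθ : θ ≠ θs) (hθ' : θ' ≠ θs) : D0 m θs ≤ sep m θs θs θ θ' :=
  ciInf_le (Set.finite_range _).bddBelow
    ((⟨θ, hθ⟩, ⟨θ', hθ'⟩) : {θ : Θ // θ ≠ θs} × {θ' : Θ // θ' ≠ θs})

theorem D1_le_sep {θ θ' θ'' : Θ} (h : θ ≠ θ') (h'' : θ'' ≠ θs) :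
    D1 m θs ≤ sep m θs θ θ' θ'' :=
  ciInf_le (Set.finite_range _).bddBelow
    ((⟨(θ, θ'), h⟩, ⟨θ'', h''⟩) : {q : Θ × Θ // q.1 ≠ q.2} × {θ' : Θ // θ' ≠ θs})

theorem D1pair_le_sep {θ θ' : Θ} (h : θ ≠ θ') (h' : θ' ≠ θs) :
    D1pair m θs ≤ sep m θs θ θ' θ' :=
  ciInf_le (Set.finite_range _).bddBelow
    (⟨(θ, θ'), h, h'⟩ : {q : Θ × Θ // q.1 ≠ q.2 ∧ q.2 ≠ θs})

theorem eta0_le (i : Fin n) {θ : Θ} (hθ : θ ≠ θs) : eta0 m θs ≤ (m i θ - m i θs) ^ 2 :=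
  ciInf_le (Set.finite_range _).bddBelow ((i, ⟨θ, hθ⟩) : Fin n × {θ : Θ // θ ≠ θs})

variable [Nontrivial Θ]

theorem eta0_pos [NeZero n] (h : ∀ i θ, θ ≠ θs → m i θ ≠ m i θs) : 0 < eta0 m θs := by
  obtain ⟨θ, hθ⟩ := exists_ne θs
  have : Nonempty (Fin n × {θ : Θ // θ ≠ θs}) := ⟨(0, ⟨θ, hθ⟩)⟩
  obtain ⟨p, hp⟩ := exists_eq_ciInf_of_finite
    (f := fun p : Fin n × {θ : Θ // θ ≠ θs} => (m p.1 p.2 - m p.1 θs) ^ 2)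
  rw [eta0, ← hp]
  exact sq_pos_of_ne_zero (sub_ne_zero.2 (h p.1 p.2 p.2.2))

theorem eta0_le_D1 [NeZero n] : eta0 m θs ≤ D1 m θs := by
  obtain ⟨θ, hθ⟩ := exists_ne θs
  have : Nonempty ({q : Θ × Θ // q.1 ≠ q.2} × {θ' : Θ // θ' ≠ θs}) :=
    ⟨(⟨(θ, θs), hθ⟩, ⟨θ, hθ⟩)⟩
  exact le_ciInf fun p => le_sep _ _ _ _ _ fun i => eta0_le m θs i p.2.2

theorem D1_le_D0 : D1 m θs ≤ D0 m θs := by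
  obtain ⟨θ, hθ⟩ := exists_ne θs
  have : Nonempty ({θ : Θ // θ ≠ θs} × {θ' : Θ // θ' ≠ θs}) := ⟨(⟨θ, hθ⟩, ⟨θ, hθ⟩)⟩
  exact le_ciInf fun p => D1_le_sep m θs p.1.2.symm p.2.2

end Minima

/-! ### Summing truncated exponential tails -/

/-- A sum of truncated geometric terms. -/
theorem tsum_min_one_mul_exp_le {A a : ℝ} (hA : 1 ≤ A) (ha : 0 < a) (ha1 : a ≤ 1) :
    ∑' k : ℕ, min 1 (ENNReal.ofReal (A * Real.exp (-(a * k)))) ≤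
      ENNReal.ofReal ((Real.log A + 4) / a) := by
  -- From this index on, `A * exp (-a * k)` is at most one; earlier terms are bounded by one each.
  set N := ⌈Real.log A / a⌉₊ with hN
  have hlog : 0 ≤ Real.log A := Real.log_nonneg hA
  have hN1 : Real.log A / a ≤ N := Nat.le_ceil _
  have hN2 : (N : ℝ) < Real.log A / a + 1 := Nat.ceil_lt_add_one (by positivity)
  have hr1 : Real.exp (-a) ≤ 1 - a / 2 := exp_neg_le ha.le ha1
  have htail : ∀ k : ℕ, min 1 (ENNReal.ofReal (A * Real.exp (-(a * (k + N : ℕ))))) ≤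
      ENNReal.ofReal (Real.exp (-a) ^ k) := fun k => by
    refine (min_le_right _ _).trans (ENNReal.ofReal_le_ofReal ?_)
    nth_rewrite 1 [← Real.exp_nat_mul, ← Real.exp_log (by linarith : 0 < A)]
    rw [← Real.exp_add]
    refine Real.exp_le_exp.2 ?_
    rw [div_le_iff₀ ha] at hN1
    push_cast
    nlinarith
  have hgeo : ∑' k : ℕ, ENNReal.ofReal (Real.exp (-a) ^ k) ≤ ENNReal.ofReal (2 / a) := by
    have hlt : Real.exp (-a) < 1 := by linarith
    rw [← ENNReal.ofReal_tsum_of_nonneg (fun k => by positivity)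
      (summable_geometric_of_lt_one (Real.exp_pos _).le hlt),
      tsum_geometric_of_lt_one (Real.exp_pos _).le hlt]
    refine ENNReal.ofReal_le_ofReal ?_
    rw [← one_div, div_le_div_iff₀ (by linarith) ha]
    linarith
  rw [← ENNReal.summable.sum_add_tsum_nat_add' (k := N)]
  calc _ ≤ ∑ k ∈ Finset.range N, (1 : ℝ≥0∞) + ∑' k : ℕ, ENNReal.ofReal (Real.exp (-a) ^ k) :=
        add_le_add (Finset.sum_le_sum fun k _ => min_le_left _ _) (ENNReal.tsum_le_tsum htail)
    _ ≤ ENNReal.ofReal N + ENNReal.ofReal (2 / a) := by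
        refine add_le_add ?_ hgeo
        simp
    _ = ENNReal.ofReal (N + 2 / a) := (ENNReal.ofReal_add (by positivity) (by positivity)).symm
    _ ≤ _ := by
        refine ENNReal.ofReal_le_ofReal ?_
        have : 1 ≤ 1 / a := by rw [le_div_iff₀ ha]; linarith
        have h4 : (Real.log A + 4) / a = Real.log A / a + 2 / a + 2 * (1 / a) := by ring
        linarith

/-! ### One round of the rule -/

namespace IsRun

variable {n : ℕ} {Θ Ω : Type*} {mΩ : MeasurableSpace Ω} {ν : Fin n → Θ → Measure ℝ} {θs : Θ}
  {P : Measure Ω} {ℱ : Filtration ℕ mΩ} {I : ℕ → Ω → Fin n} {Y : ℕ → Ω → ℝ}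
  {best second : ℕ → Ω → Θ}

/-- Integrating `reward_law` over `A` shows that, on the event of pulling arm `i`, the reward is
independent of the past with law `ν i θs`. -/
theorem measure_inter_eq [IsProbabilityMeasure P] [∀ i θ, IsProbabilityMeasure (ν i θ)]
    (h : IsRun ν θs P ℱ I Y best second) (t : ℕ) (i : Fin n) {A : Set Ω} (hA : MeasurableSet[ℱ t] A)
    {B : Set ℝ} (hB : MeasurableSet B) :
    (P.restrict {ω | I (t + 1) ω = i}) (A ∩ Y (t + 1) ⁻¹' B) =
      (P.restrict {ω | I (t + 1) ω = i}) A * ν i θs B := by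
  have hI : MeasurableSet {ω | I (t + 1) ω = i} :=
    ℱ.le (t + 1) _ (h.arm_meas (t + 1) (by omega) i)
  have hY : Measurable (Y (t + 1)) := (h.reward_meas (t + 1) (by omega)).mono (ℱ.le _) le_rfl
  have hA' := ℱ.le t _ hA
  have hIY : MeasurableSet {ω | I (t + 1) ω = i ∧ Y (t + 1) ω ∈ B} := hI.inter (hY hB)
  have h1 := setIntegral_congr_ae hA' ((h.reward_law t i B hB).mono fun ω hω _ => hω)
  rw [setIntegral_condExp (ℱ.le t) ((integrable_const (1 : ℝ)).indicator hIY) hA,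
    integral_const_mul,
    setIntegral_condExp (ℱ.le t) ((integrable_const (1 : ℝ)).indicator hI) hA,
    setIntegral_indicator hIY, setIntegral_indicator hI] at h1
  simp only [setIntegral_const, smul_eq_mul, mul_one] at h1
  rw [Measure.restrict_apply (hA'.inter (hY hB)), Measure.restrict_apply hA',
    ← ofReal_measureReal (measure_ne_top (ν i θs) B), ← ofReal_measureReal (measure_ne_top P _),
    ← ofReal_measureReal (measure_ne_top P (A ∩ _)), ← ENNReal.ofReal_mul measureReal_nonneg,
    mul_comm (P.real _), ← h1]
  congr 2
  ext ω
  simp only [Set.mem_inter_iff, Set.mem_preimage, Set.mem_ofPred_eq]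
  tauto

/-- A factor of the past times a function of the next reward and arm, integrated over the next
reward first. -/
theorem lintegral_mul_reward_eq [IsProbabilityMeasure P] [∀ i θ, IsProbabilityMeasure (ν i θ)]
    (h : IsRun ν θs P ℱ I Y best second) (t : ℕ) {G : Ω → ℝ≥0∞} (hG : Measurable[ℱ t] G)
    {φ : Fin n → ℝ → ℝ≥0∞} (hφ : ∀ i, Measurable (φ i)) :
    ∫⁻ ω, G ω * φ (I (t + 1) ω) (Y (t + 1) ω) ∂P =
      ∑ i, (∫⁻ ω in {ω | I (t + 1) ω = i}, G ω ∂P) * ∫⁻ y, φ i y ∂(ν i θs) := by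
  have hI : ∀ i, MeasurableSet {ω | I (t + 1) ω = i} := fun i =>
    ℱ.le (t + 1) _ (h.arm_meas (t + 1) (by omega) i)
  have hY : Measurable (Y (t + 1)) := (h.reward_meas (t + 1) (by omega)).mono (ℱ.le _) le_rfl
  have hU : (⋃ i, {ω | I (t + 1) ω = i}) = Set.univ := by ext; simp
  rw [← setLIntegral_univ, ← hU, lintegral_iUnion hI, tsum_fintype]
  · refine Finset.sum_congr rfl fun i _ => ?_
    rw [← lintegral_mul_comp_of_forall_measure_inter (ℱ.le t) hY
      (fun A hA B hB => h.measure_inter_eq t i hA hB) hG (hφ i)]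
    refine setLIntegral_congr_fun (hI i) fun ω hω => ?_
    rw [Set.mem_ofPred_eq] at hω
    simp only [hω]
  · intro i j hij
    refine Set.disjoint_left.2 fun ω hi hj => hij ?_
    rw [Set.mem_ofPred_eq] at hi hj
    rw [← hi, ← hj]

theorem lintegral_mul_exp_le_sum [IsProbabilityMeasure P] [∀ i θ, IsProbabilityMeasure (ν i θ)]
    {η : ℝ} (hη : 0 < η)
    (hν : ∀ i θ, ∀ᵐ y ∂(ν i θ), y ∈ Set.Icc (-(√η / 2)) (√η / 2))
    (h : IsRun ν θs P ℱ I Y best second) (t : ℕ) {G : Ω → ℝ≥0∞} (hG : Measurable[ℱ t] G) (θ : Θ) :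
    ∫⁻ ω, G ω * ENNReal.ofReal (Real.exp (-((Y (t + 1) ω - mean ν (I (t + 1) ω) θ) ^ 2 -
        (Y (t + 1) ω - mean ν (I (t + 1) ω) θs) ^ 2) / η)) ∂P ≤
      ∑ i, (∫⁻ ω in {ω | I (t + 1) ω = i}, G ω ∂P) *
        ENNReal.ofReal (Real.exp (-(mean ν i θ - mean ν i θs) ^ 2 / (2 * η))) := by
  rw [h.lintegral_mul_reward_eq t hG (φ := fun i y => ENNReal.ofReal
    (Real.exp (-((y - mean ν i θ) ^ 2 - (y - mean ν i θs) ^ 2) / η))) fun i => by fun_prop]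
  exact Finset.sum_le_sum fun i _ =>
    mul_le_mul_right (lintegral_exp_sq_sub_sq_le hη (hν i θs) _) _

/-- The first arm has an arbitrary law, so no separation is credited to round one: Hoeffding factors
are bounded by one. -/
theorem lintegral_exp_first_le [IsProbabilityMeasure P] [∀ i θ, IsProbabilityMeasure (ν i θ)]
    {η : ℝ} (hη : 0 < η)
    (hν : ∀ i θ, ∀ᵐ y ∂(ν i θ), y ∈ Set.Icc (-(√η / 2)) (√η / 2))
    (h : IsRun ν θs P ℱ I Y best second) (θ : Θ) :
    ∫⁻ ω, ENNReal.ofReal (Real.exp (-((Y 1 ω - mean ν (I 1 ω) θ) ^ 2 -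
        (Y 1 ω - mean ν (I 1 ω) θs) ^ 2) / η)) ∂P ≤ 1 := by
  have h1 := h.lintegral_mul_exp_le_sum hη hν 0 (G := fun _ => 1) measurable_const θ
  simp only [one_mul, zero_add] at h1
  refine h1.trans ?_
  -- With constant integrands this says that the probabilities of the first arms sum to one.
  have h2 := h.lintegral_mul_reward_eq 0 (G := fun _ => 1) measurable_const
    (φ := fun _ _ => 1) fun i => measurable_const
  simp only [lintegral_one, measure_univ, mul_one, zero_add] at h2
  refine (Finset.sum_le_sum fun i _ => ?_).trans_eq h2.symm
  rw [lintegral_one]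
  refine mul_le_of_le_one_right' ?_
  rw [ENNReal.ofReal_le_one, Real.exp_le_one_iff]
  rw [neg_div]
  exact neg_nonpos.2 (by positivity)

/-- A function of the two leading hypotheses is a function of the past. -/
theorem measurable_comp_leaders [Finite Θ] (h : IsRun ν θs P ℱ I Y best second) {t : ℕ}
    (ht : 1 ≤ t) {α : Type*} [MeasurableSpace α] (f : Θ → Θ → α) :
    Measurable[ℱ t] fun ω => f (best t ω) (second t ω) := by
  let _ : MeasurableSpace Θ := ⊤
  have hb : Measurable[ℱ t] (best t) :=
    @measurable_to_countable' _ _ _ _ (ℱ t) _ (h.best_meas t ht)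
  have hs : Measurable[ℱ t] (second t) :=
    @measurable_to_countable' _ _ _ _ (ℱ t) _ (h.second_meas t ht)
  exact (Measurable.of_discrete (f := fun p : Θ × Θ => f p.1 p.2)).comp (hb.prodMk hs)

theorem measurable_sqErr (h : IsRun ν θs P ℱ I Y best second) (m : Fin n → Θ → ℝ) (t : ℕ) (θ : Θ) :
    Measurable[ℱ t] fun ω => sqErr m I Y t θ ω := by
  refine Finset.measurable_fun_sum _ fun s hs => ?_
  rw [Finset.mem_Icc] at hs
  have hle := ℱ.mono hs.2
  have hY := (h.reward_meas s hs.1).mono hle le_rfl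
  have hI : Measurable[ℱ t] (I s) :=
    (@measurable_to_countable' _ _ _ _ (ℱ s) _ (h.arm_meas s hs.1)).mono hle le_rfl
  exact (hY.sub ((Measurable.of_discrete (f := fun i => m i θ)).comp hI)).pow_const 2

/-- Hoeffding's bound holds arm by arm; `arm_law` then turns the sum over arms into an average under
the sampling distribution of the current leaders. -/
theorem lintegral_mul_exp_le [IsProbabilityMeasure P] [∀ i θ, IsProbabilityMeasure (ν i θ)]
    [NeZero n] [Finite Θ] {η : ℝ} (hη : 0 < η)
    (hν : ∀ i θ, ∀ᵐ y ∂(ν i θ), y ∈ Set.Icc (-(√η / 2)) (√η / 2))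
    (h : IsRun ν θs P ℱ I Y best second) {t : ℕ} (ht : 1 ≤ t) {G : Ω → ℝ≥0∞}
    (hG : Measurable[ℱ t] G) (θ : Θ) :
    ∫⁻ ω, G ω * ENNReal.ofReal (Real.exp (-((Y (t + 1) ω - mean ν (I (t + 1) ω) θ) ^ 2 -
        (Y (t + 1) ω - mean ν (I (t + 1) ω) θs) ^ 2) / η)) ∂P ≤
      ∫⁻ ω, G ω * ENNReal.ofReal
        (Real.exp (-(sep (mean ν) θs (best t ω) (second t ω) θ / (4 * η)))) ∂P := by
  refine (h.lintegral_mul_exp_le_sum hη hν t hG θ).trans ?_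
  have hu : ∀ i, Measurable[ℱ t] fun ω => unif (mean ν) (best t ω) (second t ω) i := fun i =>
    h.measurable_comp_leaders ht fun a b => unif (mean ν) a b i
  have hI : ∀ i, MeasurableSet {ω | I (t + 1) ω = i} := fun i =>
    ℱ.le (t + 1) _ (h.arm_meas (t + 1) (by omega) i)
  have hGu : ∀ i, Measurable fun ω =>
      G ω * ENNReal.ofReal (unif (mean ν) (best t ω) (second t ω) i) := fun i =>
    (hG.mul (hu i).ennreal_ofReal).mono (ℱ.le t) le_rfl
  calc _ = ∫⁻ ω, ∑ i, G ω * ENNReal.ofReal (unif (mean ν) (best t ω) (second t ω) i) *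
        ENNReal.ofReal (Real.exp (-(mean ν i θ - mean ν i θs) ^ 2 / (2 * η))) ∂P := by
        rw [lintegral_finsetSum _ fun i _ => (hGu i).mul_const _]
        refine Finset.sum_congr rfl fun i _ => ?_
        rw [lintegral_mul_const _ (hGu i), setLIntegral_eq_lintegral_mul_condProb (ℱ.le t) (hI i)
          (h.arm_law t ht i) (hu i) (fun ω => unif_nonneg _ _ _ _) hG]
    _ ≤ _ := by
        refine lintegral_mono fun ω => ?_
        simp_rw [mul_assoc, ← Finset.mul_sum, ← ENNReal.ofReal_mul (unif_nonneg _ _ _ _)]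
        rw [← ENNReal.ofReal_sum_of_nonneg fun i _ =>
          mul_nonneg (unif_nonneg _ _ _ _) (Real.exp_pos _).le]
        exact mul_le_mul_right (ENNReal.ofReal_le_ofReal
          (sum_unif_mul_exp_le _ _ _ hη _ _ fun i => sq_mean_sub_mean_le hη hν i _ _)) _

end IsRun

/-! ### The exponential supermartingale and Chernoff's bound -/

/-- The exponential of the negative excess squared error of `θ`, compensated by its separation
under the sampling distributions in use. -/
noncomputable def compensated {n : ℕ} {Θ Ω : Type*} (m : Fin n → Θ → ℝ) (θs : Θ)
    (I : ℕ → Ω → Fin n) (Y : ℕ → Ω → ℝ) (best second : ℕ → Ω → Θ) (η : ℝ) (t : ℕ) (θ : Θ) (ω : Ω) :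
    ℝ :=
  Real.exp (-(sqErr m I Y t θ ω - sqErr m I Y t θs ω) / η +
    ∑ s ∈ Finset.Ico 1 t, sep m θs (best s ω) (second s ω) θ / (4 * η))

namespace IsRun

variable {n : ℕ} {Θ Ω : Type*} {mΩ : MeasurableSpace Ω} {ν : Fin n → Θ → Measure ℝ} {θs : Θ}
  {P : Measure Ω} {ℱ : Filtration ℕ mΩ} {I : ℕ → Ω → Fin n} {Y : ℕ → Ω → ℝ}
  {best second : ℕ → Ω → Θ}

theorem measurable_compensated [Finite Θ] (h : IsRun ν θs P ℱ I Y best second) (m : Fin n → Θ → ℝ)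
    (η : ℝ) (t : ℕ) (θ : Θ) :
    Measurable[ℱ t] (compensated m θs I Y best second η t θ) := by
  refine Real.measurable_exp.comp (Measurable.add ?_ (Finset.measurable_fun_sum _ fun s hs => ?_))
  · exact (((h.measurable_sqErr m t θ).sub (h.measurable_sqErr m t θs)).neg).div_const _
  · rw [Finset.mem_Ico] at hs
    exact ((h.measurable_comp_leaders hs.1 fun a b => sep m θs a b θ / (4 * η)).mono
      (ℱ.mono hs.2.le) le_rfl)

/-- The leaders after round `s` govern the draw of round `s + 1`, so the new compensator factor is
known one round ahead and cancels the one-step decay exactly. -/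
theorem lintegral_compensated_le_one [IsProbabilityMeasure P]
    [∀ i θ, IsProbabilityMeasure (ν i θ)] [NeZero n] [Finite Θ] {η : ℝ} (hη : 0 < η)
    (hν : ∀ i θ, ∀ᵐ y ∂(ν i θ), y ∈ Set.Icc (-(√η / 2)) (√η / 2))
    (h : IsRun ν θs P ℱ I Y best second) {t : ℕ} (ht : 1 ≤ t) (θ : Θ) :
    ∫⁻ ω, ENNReal.ofReal (compensated (mean ν) θs I Y best second η t θ ω) ∂P ≤ 1 := by
  induction t, ht using Nat.le_induction with
  | base => simpa [compensated, sqErr] using h.lintegral_exp_first_le hη hν θ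
  | succ t ht ih =>
    refine le_trans ?_ ih
    set S := fun ω => sep (mean ν) θs (best t ω) (second t ω) θ / (4 * η)
    have hS : Measurable[ℱ t] S :=
      h.measurable_comp_leaders ht fun a b => sep (mean ν) θs a b θ / (4 * η)
    have hG : Measurable[ℱ t] fun ω =>
        ENNReal.ofReal (compensated (mean ν) θs I Y best second η t θ ω * Real.exp (S ω)) :=
      ((h.measurable_compensated (mean ν) η t θ).mul hS.exp).ennreal_ofReal
    refine le_of_eq_of_le ?_ ((h.lintegral_mul_exp_le hη hν ht hG θ).trans_eq ?_)
    · refine lintegral_congr fun ω => ?_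
      rw [← ENNReal.ofReal_mul (by unfold compensated; positivity), compensated, compensated,
        ← Real.exp_add, ← Real.exp_add, Finset.sum_Ico_succ_top ht, sqErr, sqErr, sqErr, sqErr,
        Finset.sum_Icc_succ_top (by omega), Finset.sum_Icc_succ_top (by omega)]
      congr 2
      ring
    · refine lintegral_congr fun ω => ?_
      rw [← ENNReal.ofReal_mul (by unfold compensated; positivity), mul_assoc, ← Real.exp_add]
      simp [S]

/-- Chernoff's bound: it is unlikely that the excess squared error of a hypothesis stays small
although it was well separated. -/
theorem measure_sqErr_sub_le_and_le_sum [IsProbabilityMeasure P]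
    [∀ i θ, IsProbabilityMeasure (ν i θ)] [NeZero n] [Finite Θ] {η : ℝ} (hη : 0 < η)
    (hν : ∀ i θ, ∀ᵐ y ∂(ν i θ), y ∈ Set.Icc (-(√η / 2)) (√η / 2))
    (h : IsRun ν θs P ℱ I Y best second) {t : ℕ} (ht : 1 ≤ t) (θ : Θ) (x y : ℝ) :
    P {ω | sqErr (mean ν) I Y t θ ω - sqErr (mean ν) I Y t θs ω ≤ x ∧
      y ≤ ∑ s ∈ Finset.Ico 1 t, sep (mean ν) θs (best s ω) (second s ω) θ / (4 * η)} ≤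
      ENNReal.ofReal (Real.exp (x / η - y)) := by
  have hmeas := ((h.measurable_compensated (mean ν) η t θ).mono (ℱ.le t) le_rfl).ennreal_ofReal
  have hmk := mul_meas_ge_le_lintegral₀ (μ := P) hmeas.aemeasurable
    (ENNReal.ofReal (Real.exp (-(x / η - y))))
  have h1 := hmk.trans (h.lintegral_compensated_le_one hη hν ht θ)
  have h2 : P {ω | sqErr (mean ν) I Y t θ ω - sqErr (mean ν) I Y t θs ω ≤ x ∧
      y ≤ ∑ s ∈ Finset.Ico 1 t, sep (mean ν) θs (best s ω) (second s ω) θ / (4 * η)} ≤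
      P {ω | ENNReal.ofReal (Real.exp (-(x / η - y))) ≤
        ENNReal.ofReal (compensated (mean ν) θs I Y best second η t θ ω)} := by
    refine measure_mono fun ω hω => ENNReal.ofReal_le_ofReal (Real.exp_le_exp.2 ?_)
    have := div_le_div_of_nonneg_right hω.1 hη.le
    rw [neg_div]
    linarith [hω.2]
  refine h2.trans ?_
  calc _ = ENNReal.ofReal (Real.exp (x / η - y)) *
        (ENNReal.ofReal (Real.exp (-(x / η - y))) * P _) := by
        rw [← mul_assoc, ← ENNReal.ofReal_mul (Real.exp_pos _).le, ← Real.exp_add, add_neg_cancel,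
          Real.exp_zero, ENNReal.ofReal_one, one_mul]
    _ ≤ _ := mul_le_of_le_one_right' h1

end IsRun

/-! ### Tails and expectation of the stopping time -/

/-- The event that some wrong hypothesis has a small excess squared error after round `t`, that is,
that the rule may still be running. -/
def running {n : ℕ} {Θ Ω : Type*} (m : Fin n → Θ → ℝ) (θs : Θ) (I : ℕ → Ω → Fin n) (Y : ℕ → Ω → ℝ)
    (β : ℝ) (t : ℕ) : Set Ω :=
  {ω | ∃ θ, θ ≠ θs ∧ sqErr m I Y t θ ω - sqErr m I Y t θs ω ≤ β}

namespace IsRun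

variable {n : ℕ} {Θ Ω : Type*} {mΩ : MeasurableSpace Ω} {ν : Fin n → Θ → Measure ℝ} {θs : Θ}
  {P : Measure Ω} {ℱ : Filtration ℕ mΩ} {I : ℕ → Ω → Fin n} {Y : ℕ → Ω → ℝ}
  {best second : ℕ → Ω → Θ}

/-- It is unlikely that a wrong hypothesis leads. -/
theorem measure_best_ne_le [IsProbabilityMeasure P]
    [∀ i θ, IsProbabilityMeasure (ν i θ)] [NeZero n] [Fintype Θ] {η : ℝ} (hη : 0 < η)
    (hν : ∀ i θ, ∀ᵐ y ∂(ν i θ), y ∈ Set.Icc (-(√η / 2)) (√η / 2))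
    (h : IsRun ν θs P ℱ I Y best second) {t : ℕ} (ht : 1 ≤ t) :
    P {ω | best t ω ≠ θs} ≤ ENNReal.ofReal
      (Fintype.card Θ * Real.exp (-(D1 (mean ν) θs / (4 * η) * (t - 1 : ℕ)))) := by
  calc P {ω | best t ω ≠ θs}
      ≤ P (⋃ θ ∈ Finset.univ, {ω | sqErr (mean ν) I Y t θ ω - sqErr (mean ν) I Y t θs ω ≤ 0 ∧
          D1 (mean ν) θs / (4 * η) * (t - 1 : ℕ) ≤
            ∑ s ∈ Finset.Ico 1 t, sep (mean ν) θs (best s ω) (second s ω) θ / (4 * η)}) := by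
        -- A wrong leader itself has nonpositive excess.
        refine measure_mono fun ω hω => Set.mem_iUnion₂.2 ⟨best t ω, Finset.mem_univ _, ?_, ?_⟩
        · exact sub_nonpos.2 (h.best_min t ht ω θs)
        · calc _ = ∑ s ∈ Finset.Ico 1 t, D1 (mean ν) θs / (4 * η) := by
                simp [mul_comm]
            _ ≤ _ := Finset.sum_le_sum fun s hs => by
                gcongr
                exact D1_le_sep _ _ (h.second_ne s (Finset.mem_Ico.1 hs).1 ω).symm hω
    _ ≤ ∑ θ : Θ, ENNReal.ofReal
          (Real.exp (0 / η - D1 (mean ν) θs / (4 * η) * (t - 1 : ℕ))) :=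
        (measure_biUnion_finset_le _ _).trans (Finset.sum_le_sum fun θ _ =>
          h.measure_sqErr_sub_le_and_le_sum hη hν ht θ _ _)
    _ = _ := by
        rw [Finset.sum_const, Finset.card_univ, nsmul_eq_mul, ENNReal.ofReal_mul (by positivity),
          ENNReal.ofReal_natCast, zero_div, zero_sub]

/-- If every wrong hypothesis has a large excess squared error, the rule has stopped. -/
theorem stopTime_le (h : IsRun ν θs P ℱ I Y best second) {β : ℝ} (hβ : 0 ≤ β) {t : ℕ}
    (ht : 2 ≤ t) {ω : Ω}
    (hlt : ∀ θ, θ ≠ θs → β < sqErr (mean ν) I Y t θ ω - sqErr (mean ν) I Y t θs ω) :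
    stopTime (mean ν) I Y best β ω ≤ t := by
  have hb : best t ω = θs := by
    by_contra hne
    linarith [hlt _ hne, h.best_min t (by omega) ω θs]
  refine iInf_le_of_le ⟨t, ht, ?_⟩ le_rfl
  rw [hb]
  exact hlt

theorem measurableSet_running [Countable Θ] (h : IsRun ν θs P ℱ I Y best second)
    (m : Fin n → Θ → ℝ) (β : ℝ) (t : ℕ) : MeasurableSet (running m θs I Y β t) := by
  have : running m θs I Y β t = ⋃ θ, ⋃ _ : θ ≠ θs,
      {ω | sqErr m I Y t θ ω - sqErr m I Y t θs ω ≤ β} := by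
    ext; simp [running]
  rw [this]
  exact MeasurableSet.iUnion fun θ => MeasurableSet.iUnion fun _ =>
    measurableSet_le (((h.measurable_sqErr m t θ).sub (h.measurable_sqErr m t θs)).mono
      (ℱ.le t) le_rfl) measurable_const

/-- Either a wrong hypothesis leads in one of the rounds `k, ..., 2 * k - 1`, or `θs` leads in all
of them and every wrong hypothesis collects `D0` from each; a union bound treats both cases. -/
theorem measure_running_le [IsProbabilityMeasure P]
    [∀ i θ, IsProbabilityMeasure (ν i θ)] [NeZero n] [Fintype Θ] {η : ℝ} (hη : 0 < η)
    (hν : ∀ i θ, ∀ᵐ y ∂(ν i θ), y ∈ Set.Icc (-(√η / 2)) (√η / 2))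
    (h : IsRun ν θs P ℱ I Y best second) (hD : 0 < D1 (mean ν) θs) (hDη : D1 (mean ν) θs ≤ η)
    (β : ℝ) {k : ℕ} (hk : 1 ≤ k) :
    P (running (mean ν) θs I Y β (2 * k)) ≤
      ENNReal.ofReal (4 * Fintype.card Θ / (D1 (mean ν) θs / (4 * η)) *
        Real.exp (-(D1 (mean ν) θs / (4 * η) * k))) +
      ENNReal.ofReal (Fintype.card Θ * Real.exp (β / η) *
        Real.exp (-(D0 (mean ν) θs / (4 * η) * k))) := by
  set a := D1 (mean ν) θs / (4 * η) with ha
  set b := D0 (mean ν) θs / (4 * η) with hb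
  have ha0 : 0 < a := by positivity
  have ha1 : a ≤ 1 / 4 := by
    rw [ha, div_le_div_iff₀ (by positivity) (by norm_num)]; linarith
  have hsub : running (mean ν) θs I Y β (2 * k) ⊆
      (⋃ s ∈ Finset.Ico k (2 * k), {ω | best s ω ≠ θs}) ∪
      ⋃ θ ∈ Finset.univ, {ω | sqErr (mean ν) I Y (2 * k) θ ω - sqErr (mean ν) I Y (2 * k) θs ω ≤ β ∧
        b * k ≤ ∑ s ∈ Finset.Ico 1 (2 * k),
          sep (mean ν) θs (best s ω) (second s ω) θ / (4 * η)} := by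
    rintro ω ⟨θ, hθ, hω⟩
    by_cases hbest : ∃ s ∈ Finset.Ico k (2 * k), best s ω ≠ θs
    · obtain ⟨s, hs, hne⟩ := hbest
      exact Or.inl (Set.mem_iUnion₂.2 ⟨s, hs, hne⟩)
    push Not at hbest
    refine Or.inr (Set.mem_iUnion₂.2 ⟨θ, Finset.mem_univ _, hω, ?_⟩)
    calc b * k = ∑ s ∈ Finset.Ico k (2 * k), b := by
          rw [Finset.sum_const, Nat.card_Ico, nsmul_eq_mul, show 2 * k - k = k by omega, mul_comm]
      _ ≤ ∑ s ∈ Finset.Ico k (2 * k), sep (mean ν) θs (best s ω) (second s ω) θ / (4 * η) := by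
          refine Finset.sum_le_sum fun s hs => ?_
          have hs1 : 1 ≤ s := hk.trans (Finset.mem_Ico.1 hs).1
          have hne := h.second_ne s hs1 ω
          rw [hbest s hs] at hne ⊢
          exact div_le_div_of_nonneg_right (D0_le_sep _ _ hne hθ) (by positivity)
      _ ≤ _ := Finset.sum_le_sum_of_subset_of_nonneg (Finset.Ico_subset_Ico_left hk)
          fun s _ _ => div_nonneg (sep_nonneg _ _ _ _ _) (by positivity)
  refine (measure_mono hsub).trans ((measure_union_le _ _).trans (add_le_add ?_ ?_))
  · have hr1 : Real.exp (-a) ≤ 1 - a / 2 := by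
      rw [Real.exp_neg, inv_le_comm₀ (Real.exp_pos _) (by linarith)]
      refine le_trans ?_ (Real.add_one_le_exp _)
      rw [inv_le_iff_one_le_mul₀ (by linarith)]
      nlinarith
    -- The constant `4 / a` is the product of this factor, due to the shift `s - 1`, and the
    -- geometric sum `2 / a`.
    have hea : Real.exp a ≤ 2 := by
      rw [← Real.exp_log (show (0 : ℝ) < 2 by norm_num)]
      exact Real.exp_le_exp.2 (by linarith [Real.log_two_gt_d9])
    calc _ ≤ ∑ s ∈ Finset.Ico k (2 * k), P {ω | best s ω ≠ θs} := measure_biUnion_finset_le _ _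
      _ ≤ ∑ s ∈ Finset.Ico k (2 * k),
          ENNReal.ofReal (Fintype.card Θ * Real.exp (-(a * (s - 1 : ℕ)))) :=
          Finset.sum_le_sum fun s hs =>
            h.measure_best_ne_le hη hν (hk.trans (Finset.mem_Ico.1 hs).1)
      _ = ENNReal.ofReal (∑ s ∈ Finset.Ico k (2 * k),
          Fintype.card Θ * Real.exp (-(a * (s - 1 : ℕ)))) :=
          (ENNReal.ofReal_sum_of_nonneg fun s _ => by positivity).symm
      _ ≤ _ := by
          refine ENNReal.ofReal_le_ofReal ?_
          have hterm : ∀ j : ℕ, Real.exp (-(a * (k + j - 1 : ℕ))) =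
              Real.exp a * Real.exp (-(a * k)) * Real.exp (-a) ^ j := fun j => by
            rw [← Real.exp_nat_mul, ← Real.exp_add, ← Real.exp_add, Nat.cast_sub (by omega)]
            congr 1
            push_cast
            ring
          rw [Finset.sum_Ico_eq_sum_range, ← Finset.mul_sum]
          simp_rw [hterm]
          rw [← Finset.mul_sum]
          have hgeo : ∑ j ∈ Finset.range (2 * k - k), Real.exp (-a) ^ j ≤ 2 / a := by
            have hlt : Real.exp (-a) < 1 := by linarith
            refine (Summable.sum_le_tsum _ (fun j _ => by positivity)
              (summable_geometric_of_lt_one (Real.exp_pos _).le hlt)).trans ?_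
            rw [tsum_geometric_of_lt_one (Real.exp_pos _).le hlt, ← one_div,
              div_le_div_iff₀ (by linarith) ha0]
            linarith
          calc _ ≤ Fintype.card Θ * (2 * Real.exp (-(a * k)) * (2 / a)) := by gcongr
            _ = _ := by ring
  · calc _ ≤ ∑ θ : Θ, ENNReal.ofReal (Real.exp (β / η - b * k)) :=
          (measure_biUnion_finset_le _ _).trans (Finset.sum_le_sum fun θ _ =>
            h.measure_sqErr_sub_le_and_le_sum hη hν (by omega) θ _ _)
      _ = _ := by
          rw [Finset.sum_const, Finset.card_univ, nsmul_eq_mul, mul_assoc,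
            ENNReal.ofReal_mul (by positivity), ENNReal.ofReal_natCast, ← Real.exp_add,
            sub_eq_add_neg]

/-- The stopping time is controlled by the number of even rounds in which the rule may still be
running. -/
theorem stopTime_le_tsum (h : IsRun ν θs P ℱ I Y best second) {β : ℝ} (hβ : 0 ≤ β)
    (ω : Ω) :
    (stopTime (mean ν) I Y best β ω : ℝ≥0∞) ≤
      2 + 2 * ∑' k : ℕ, (running (mean ν) θs I Y β (2 * (k + 1))).indicator 1 ω := by
  classical
  -- If `k` is the first index outside `running`, the rule stops by round `2 * (k + 1)` and exactly
  -- the `k` earlier indicators are known to be one.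
  by_cases hex : ∃ k : ℕ, ω ∉ running (mean ν) θs I Y β (2 * (k + 1))
  · have hle : (stopTime (mean ν) I Y best β ω) ≤ ((2 * (Nat.find hex + 1) : ℕ) : ℕ∞) := by
      refine h.stopTime_le hβ (by omega) fun θ hθ => ?_
      by_contra hle
      exact Nat.find_spec hex ⟨θ, hθ, not_lt.1 hle⟩
    have hsum : (Nat.find hex : ℝ≥0∞) ≤
        ∑' k : ℕ, (running (mean ν) θs I Y β (2 * (k + 1))).indicator 1 ω := by
      refine le_trans (le_of_eq ?_) (ENNReal.sum_le_tsum (Finset.range (Nat.find hex)))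
      rw [Finset.sum_congr rfl (g := fun _ => (1 : ℝ≥0∞)) fun k hk => ?_]
      · simp
      · have := Nat.find_min hex (Finset.mem_range.1 hk)
        rw [not_not] at this
        simp [this]
    calc _ ≤ (((2 * (Nat.find hex + 1) : ℕ) : ℕ∞) : ℝ≥0∞) := ENat.toENNReal_le.2 hle
      _ = 2 + 2 * (Nat.find hex : ℝ≥0∞) := by
          rw [ENat.toENNReal_coe]; push_cast; ring
      _ ≤ _ := by gcongr
  · push Not at hex
    have : ∑' k : ℕ, (running (mean ν) θs I Y β (2 * (k + 1))).indicator (1 : Ω → ℝ≥0∞) ω = ∞ := by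
      rw [tsum_congr (g := fun _ => (1 : ℝ≥0∞)) fun k => by simp [hex k]]
      exact ENNReal.tsum_const_eq_top_of_ne_zero one_ne_zero
    rw [this]
    simp

theorem lintegral_stopTime_le [IsProbabilityMeasure P]
    [∀ i θ, IsProbabilityMeasure (ν i θ)] [NeZero n] [Fintype Θ] [Nontrivial Θ] {η : ℝ}
    (hη : 0 < η) (hν : ∀ i θ, ∀ᵐ y ∂(ν i θ), y ∈ Set.Icc (-(√η / 2)) (√η / 2))
    (h : IsRun ν θs P ℱ I Y best second) (hD : 0 < D1 (mean ν) θs) (hD0η : D0 (mean ν) θs ≤ η)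
    {β : ℝ} (hβ : 0 ≤ β) :
    ∫⁻ ω, (stopTime (mean ν) I Y best β ω : ℝ≥0∞) ∂P ≤ ENNReal.ofReal
      (2 + 2 * ((Real.log (4 * Fintype.card Θ / (D1 (mean ν) θs / (4 * η))) + 4) /
          (D1 (mean ν) θs / (4 * η)) +
        (Real.log (Fintype.card Θ * Real.exp (β / η)) + 4) / (D0 (mean ν) θs / (4 * η)))) := by
  have hDD := D1_le_D0 (mean ν) θs
  have hprob := fun (k : ℕ) (hk : 1 ≤ k) =>
    h.measure_running_le hη hν hD (hDD.trans hD0η) β hk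
  set a := D1 (mean ν) θs / (4 * η) with ha
  set b := D0 (mean ν) θs / (4 * η) with hb
  have ha0 : 0 < a := by positivity
  have hab : a ≤ b := by rw [ha, hb]; gcongr
  have hb1 : b ≤ 1 := by rw [hb, div_le_one (by positivity)]; linarith
  have hJ : (1 : ℝ) ≤ Fintype.card Θ := by exact_mod_cast Fintype.card_pos
  set A := 4 * Fintype.card Θ / a
  set B := Fintype.card Θ * Real.exp (β / η)
  have hA : 1 ≤ A := by
    rw [one_le_div ha0]; linarith
  have hB : 1 ≤ B := one_le_mul_of_one_le_of_one_le hJ (Real.one_le_exp (by positivity))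
  -- Each probability is also at most one, so both tails may be truncated separately; the shift from
  -- `k + 1` to `k` only weakens them.
  have hterm : ∀ k : ℕ, P (running (mean ν) θs I Y β (2 * (k + 1))) ≤
      min 1 (ENNReal.ofReal (A * Real.exp (-(a * k)))) +
      min 1 (ENNReal.ofReal (B * Real.exp (-(b * k)))) := by
    intro k
    have h1 : ENNReal.ofReal (A * Real.exp (-(a * (k + 1 : ℕ)))) ≤
        ENNReal.ofReal (A * Real.exp (-(a * k))) := by
      gcongr
      omega
    have h2 : ENNReal.ofReal (B * Real.exp (-(b * (k + 1 : ℕ)))) ≤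
        ENNReal.ofReal (B * Real.exp (-(b * k))) := by
      have : 0 ≤ b := by linarith
      gcongr
      omega
    have h3 := (hprob (k + 1) (by omega)).trans (add_le_add h1 h2)
    have h4 : P (running (mean ν) θs I Y β (2 * (k + 1))) ≤ 1 := prob_le_one
    rcases min_cases (1 : ℝ≥0∞) (ENNReal.ofReal (A * Real.exp (-(a * k)))) with h5 | h5 <;>
    rcases min_cases (1 : ℝ≥0∞) (ENNReal.ofReal (B * Real.exp (-(b * k)))) with h6 | h6 <;>
    rw [h5.1, h6.1]
    · exact h4.trans le_self_add
    · exact h4.trans le_self_add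
    · exact h4.trans le_add_self
    · exact h3
  have hlogA := Real.log_nonneg hA
  have hlogB := Real.log_nonneg hB
  have hb0 : 0 < b := by linarith
  have hx : 0 ≤ (Real.log A + 4) / a := div_nonneg (by linarith) ha0.le
  have hy : 0 ≤ (Real.log B + 4) / b := div_nonneg (by linarith) hb0.le
  have hmeas : ∀ k : ℕ, Measurable
      ((running (mean ν) θs I Y β (2 * (k + 1))).indicator (1 : Ω → ℝ≥0∞)) := fun k =>
    measurable_one.indicator (h.measurableSet_running _ _ _)
  calc _ ≤ ∫⁻ ω, (2 + 2 * ∑' k : ℕ,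
        (running (mean ν) θs I Y β (2 * (k + 1))).indicator 1 ω) ∂P :=
        lintegral_mono fun ω => h.stopTime_le_tsum hβ ω
    _ = 2 + 2 * ∑' k : ℕ, P (running (mean ν) θs I Y β (2 * (k + 1))) := by
        rw [lintegral_add_left measurable_const, lintegral_const, measure_univ, mul_one,
          lintegral_const_mul _ (Measurable.tsum hmeas),
          lintegral_tsum fun k => (hmeas k).aemeasurable]
        congr 3
        ext k
        rw [lintegral_indicator_one (h.measurableSet_running _ _ _)]
    _ ≤ 2 + 2 * (ENNReal.ofReal ((Real.log A + 4) / a) + ENNReal.ofReal ((Real.log B + 4) / b)) := by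
        gcongr
        refine (ENNReal.tsum_le_tsum hterm).trans ?_
        rw [ENNReal.tsum_add]
        exact add_le_add (tsum_min_one_mul_exp_le hA ha0 (hab.trans hb1))
          (tsum_min_one_mul_exp_le hB hb0 hb1)
    _ = _ := by
        rw [ENNReal.ofReal_add (by norm_num) (by linarith), ENNReal.ofReal_mul (by norm_num),
          ENNReal.ofReal_add hx hy, ENNReal.ofReal_ofNat]

end IsRun

/-! ### Numerical comparison with the three-term expression -/

/-- The expected stopping time in terms of the three-term expression, for every constant that
dominates the ratio of the range of the rewards to the separation. -/
theorem two_add_le_mul_bound {η η₀ J δ d₀ d₁ : ℝ} (hη₀ : 0 < η₀) (hη : 0 < η)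
    (hJ : 2 ≤ J) (hδ : 0 < δ) (hδ1 : δ ≤ 1) (h₁ : η₀ ≤ d₁) (h₀₁ : d₁ ≤ d₀) (h₀ : d₀ ≤ η) :
    2 + 2 * ((Real.log (4 * J / (d₁ / (4 * η))) + 4) / (d₁ / (4 * η)) +
      (Real.log (J * Real.exp (Real.log (J / δ) / η)) + 4) / (d₀ / (4 * η))) ≤
      200 * bound η (44 + η ^ 2 / η₀ ^ 2) J δ d₀ d₁ := by
  have hd₁ : 0 < d₁ := hη₀.trans_le h₁
  have hd₀ : 0 < d₀ := hd₁.trans_le h₀₁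
  have hJ0 : 0 < J := by linarith
  set c := Real.log (44 + η ^ 2 / η₀ ^ 2) with hc
  set l := Real.log J with hl
  set β := Real.log (J / δ) with hβd
  have hβ : 0 ≤ β := Real.log_nonneg (by rw [le_div_iff₀ hδ]; linarith)
  have hl2 : 0.69 ≤ l := by
    have := Real.log_le_log (by norm_num) hJ
    linarith [Real.log_two_gt_d9]
  have hlog4 : Real.log 4 ≤ 1.4 := by
    rw [show (4 : ℝ) = 2 ^ 2 by norm_num, Real.log_pow]
    push_cast
    linarith [Real.log_two_lt_d9]
  have hc3 : 3 ≤ c := by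
    have : Real.log (2 ^ 5) ≤ c := Real.log_le_log (by norm_num) (by
      have : 0 ≤ η ^ 2 / η₀ ^ 2 := by positivity
      linarith)
    rw [Real.log_pow] at this
    push_cast at this
    linarith [Real.log_two_gt_d9]
  -- This is where `η ^ 2 / η₀ ^ 2` in the constant is needed: it dominates the square of `η / d₁`.
  have hratio : Real.log (η / d₁) ≤ c / 2 := by
    have h1 : Real.log (η / d₁) ≤ Real.log (η / η₀) :=
      Real.log_le_log (by positivity) (by gcongr)
    have h2 : Real.log ((η / η₀) ^ 2) ≤ c := Real.log_le_log (by positivity) (by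
      rw [div_pow]; linarith)
    rw [Real.log_pow] at h2
    push_cast at h2
    linarith
  have hA : Real.log (4 * J / (d₁ / (4 * η))) = Real.log 4 + Real.log 4 + l + Real.log (η / d₁) := by
    rw [show 4 * J / (d₁ / (4 * η)) = 4 * 4 * J * (η / d₁) by field_simp,
      Real.log_mul (by positivity) (by positivity), Real.log_mul (by positivity) (by positivity),
      Real.log_mul (by positivity) (by positivity)]
  have hB : Real.log (J * Real.exp (β / η)) = l + β / η := by
    rw [Real.log_mul (by positivity) (by positivity), Real.log_exp]
  have hlc : 3 * l ≤ l * c := by nlinarith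
  have hlc' : 0.69 * c ≤ l * c := by nlinarith
  have hx : 1 ≤ η / d₁ := by rw [one_le_div hd₁]; linarith
  rw [hA, hB, bound]
  have hfirst : (Real.log 4 + Real.log 4 + l + Real.log (η / d₁) + 4) / (d₁ / (4 * η)) ≤
      24 * (η * c * l / d₁) := by
    rw [show 24 * (η * c * l / d₁) = 6 * (l * c) / (d₁ / (4 * η)) by field_simp; ring]
    gcongr
    linarith
  have hsecond : (l + β / η + 4) / (d₀ / (4 * η)) ≤ 16 * (η * c * l / d₁) + 4 * (β / d₀) := by
    -- Since `d₁ ≤ d₀`, the part without `β` is absorbed into the first term of `bound`.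
    have h1 : (l + 4) / (d₀ / (4 * η)) ≤ 4 * (l * c) / (d₁ / (4 * η)) := by
      gcongr
      linarith
    have h2 : (l + β / η + 4) / (d₀ / (4 * η)) = (l + 4) / (d₀ / (4 * η)) + 4 * (β / d₀) := by
      field_simp
      ring
    have h3 : 4 * (l * c) / (d₁ / (4 * η)) = 16 * (η * c * l / d₁) := by field_simp; ring
    linarith
  have htwo : 2 ≤ 2 * (η * c * l / d₁) := by
    have h1 : η * c * l / d₁ = η / d₁ * (l * c) := by ring
    rw [h1]
    nlinarith
  have hlast : 0 ≤ J * (44 + η ^ 2 / η₀ ^ 2) ^ (1 / η) * δ ^ (d₀ / η ^ 2) := by positivity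
  have : 0 ≤ β / d₀ := by positivity
  linarith

/-- The expected stopping time is at most a multiple of the three-term expression. -/
theorem IsRun.lintegral_stopTime_le_bound {n : ℕ} {Θ Ω : Type*} {mΩ : MeasurableSpace Ω}
    {ν : Fin n → Θ → Measure ℝ} {θs : Θ} {P : Measure Ω} {ℱ : Filtration ℕ mΩ} {I : ℕ → Ω → Fin n}
    {Y : ℕ → Ω → ℝ} {best second : ℕ → Ω → Θ} [IsProbabilityMeasure P]
    [∀ i θ, IsProbabilityMeasure (ν i θ)] [NeZero n] [Fintype Θ] [Nontrivial Θ] {η δ : ℝ}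
    (hη : 0 < η) (hδ : 0 < δ) (hδ1 : δ ≤ 1)
    (hν : ∀ i θ, ∀ᵐ y ∂(ν i θ), y ∈ Set.Icc (-(√η / 2)) (√η / 2))
    (hne : ∀ i θ, θ ≠ θs → mean ν i θ ≠ mean ν i θs)
    (h : IsRun ν θs P ℱ I Y best second) :
    ∫⁻ ω, (stopTime (mean ν) I Y best (Real.log (Fintype.card Θ / δ)) ω : ℝ≥0∞) ∂P ≤
      ENNReal.ofReal (200 * bound η (44 + η ^ 2 / eta0 (mean ν) θs ^ 2) (Fintype.card Θ) δ
        (D0 (mean ν) θs) (D1 (mean ν) θs)) := by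
  have h0 := eta0_pos (mean ν) θs hne
  have h1 := eta0_le_D1 (mean ν) θs
  have hJ : (2 : ℝ) ≤ Fintype.card Θ := by exact_mod_cast Fintype.one_lt_card (α := Θ)
  have hD0 : D0 (mean ν) θs ≤ η := by
    obtain ⟨θ, hθ⟩ := exists_ne θs
    exact (D0_le_sep _ _ hθ hθ).trans
      (sep_le _ _ _ _ _ fun i => sq_mean_sub_mean_le hη hν i _ _)
  have hβ : 0 ≤ Real.log (Fintype.card Θ / δ) :=
    Real.log_nonneg (by rw [le_div_iff₀ hδ]; linarith)
  exact (h.lintegral_stopTime_le hη hν (h0.trans_le h1) hD0 hβ).trans (ENNReal.ofReal_le_ofReal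
    (two_add_le_mul_bound h0 hη hJ hδ hδ1 h1 (D1_le_D0 _ _) hD0))

/-- A constant whose logarithm dominates `log (44 + b ^ 2 / a ^ 2)` by a factor `b / a`. -/
noncomputable def pairConst (a b : ℝ) : ℝ :=
  (44 + b ^ 2 / a ^ 2) ^ max 1 (b / a)

theorem one_lt_pairConst (a b : ℝ) : 1 < pairConst a b := by
  have : 0 ≤ b ^ 2 / a ^ 2 := by positivity
  exact Real.one_lt_rpow (by linarith) (by positivity)

/-- Replacing the separation `D1` by a possibly larger one is paid for by the constant. -/
theorem bound_le_bound_pairConst {η η₀ J δ d₀ d₁ d₂ : ℝ} (hη₀ : 0 < η₀) (hη : 0 < η) (hJ : 1 ≤ J)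
    (hδ : 0 < δ) (h₁ : η₀ ≤ d₁) (h₂ : 0 < d₂) (h₂' : d₂ ≤ η) :
    bound η (44 + η ^ 2 / η₀ ^ 2) J δ d₀ d₁ ≤ bound η (pairConst η₀ η) J δ d₀ d₂ := by
  have hC : 1 ≤ 44 + η ^ 2 / η₀ ^ 2 := by
    have : 0 ≤ η ^ 2 / η₀ ^ 2 := by positivity
    linarith
  have hlog := Real.log_nonneg hC
  have hlJ := Real.log_nonneg hJ
  have hle : 44 + η ^ 2 / η₀ ^ 2 ≤ pairConst η₀ η :=
    Real.self_le_rpow_of_one_le hC (le_max_left _ _)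
  unfold bound
  have hfirst : η * Real.log (44 + η ^ 2 / η₀ ^ 2) * Real.log J / d₁ ≤
      η * Real.log (pairConst η₀ η) * Real.log J / d₂ := by
    -- The exchange rests on `1 / d₁ ≤ 1 / η₀ = (η / η₀) / η ≤ (η / η₀) / d₂`.
    calc _ ≤ η * Real.log (44 + η ^ 2 / η₀ ^ 2) * Real.log J / η₀ := by gcongr
      _ = η * (η / η₀ * Real.log (44 + η ^ 2 / η₀ ^ 2)) * Real.log J / η := by field_simp
      _ ≤ η * (max 1 (η / η₀) * Real.log (44 + η ^ 2 / η₀ ^ 2)) * Real.log J / d₂ := by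
          gcongr
          exact le_max_right _ _
      _ = _ := by rw [pairConst, Real.log_rpow (by linarith)]
  gcongr

end TopTwo

theorem theorem3 :
    ∃ K : ℝ, 0 < K ∧ ∃ C : ℝ → ℝ → ℝ, (∀ a b : ℝ, 0 < a → 0 < b → 1 < C a b) ∧
      ∀ (n : ℕ) (Θ : Type*) [Fintype Θ] [Nontrivial Θ]
        (ν : Fin n → Θ → Measure ℝ) (θs : Θ) (η δ : ℝ)
        (Ω : Type*) (mΩ : MeasurableSpace Ω) (P : Measure Ω) [IsProbabilityMeasure P]
        (ℱ : Filtration ℕ mΩ) (I : ℕ → Ω → Fin n) (Y : ℕ → Ω → ℝ) (best second : ℕ → Ω → Θ),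
        0 < η → 0 < δ → δ ≤ 1 →
        (∀ i θ, IsProbabilityMeasure (ν i θ)) →
        (∀ i θ, ∀ᵐ y ∂(ν i θ), y ∈ Set.Icc (-(√η / 2)) (√η / 2)) →
        (∀ i θ, θ ≠ θs → TopTwo.mean ν i θ ≠ TopTwo.mean ν i θs) →
        TopTwo.IsRun ν θs P ℱ I Y best second →
        (0 < TopTwo.D1 (TopTwo.mean ν) θs →
          ∫⁻ ω, (TopTwo.stopTime (TopTwo.mean ν) I Y best
              (Real.log (Fintype.card Θ / δ)) ω : ℝ≥0∞) ∂P ≤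
            ENNReal.ofReal (K * TopTwo.bound η
              (44 + η ^ 2 / TopTwo.eta0 (TopTwo.mean ν) θs ^ 2) (Fintype.card Θ) δ
              (TopTwo.D0 (TopTwo.mean ν) θs) (TopTwo.D1 (TopTwo.mean ν) θs))) ∧
        (0 < TopTwo.D1pair (TopTwo.mean ν) θs →
          ∫⁻ ω, (TopTwo.stopTime (TopTwo.mean ν) I Y best
              (Real.log (Fintype.card Θ / δ)) ω : ℝ≥0∞) ∂P ≤
            ENNReal.ofReal (K * TopTwo.bound η
              (C (TopTwo.eta0 (TopTwo.mean ν) θs) η) (Fintype.card Θ) δ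
              (TopTwo.D0 (TopTwo.mean ν) θs) (TopTwo.D1pair (TopTwo.mean ν) θs))) := by
  refine ⟨200, by norm_num, TopTwo.pairConst, fun a b _ _ => TopTwo.one_lt_pairConst a b, ?_⟩
  intro n Θ _ _ ν θs η δ Ω mΩ P _ ℱ I Y best second hη hδ hδ1 hprob hν hne h
  obtain ⟨ω⟩ := nonempty_of_isProbabilityMeasure P
  -- A probability space is nonempty, so some arm exists.
  have hn : NeZero n := ⟨by rintro rfl; exact (I 0 ω).elim0⟩
  have hmain := h.lintegral_stopTime_le_bound hη hδ hδ1 hν hne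
  refine ⟨fun _ => hmain, fun hD => hmain.trans (ENNReal.ofReal_le_ofReal ?_)⟩
  have hJ : (1 : ℝ) ≤ Fintype.card Θ := by exact_mod_cast Fintype.card_pos
  have hDη : TopTwo.D1pair (TopTwo.mean ν) θs ≤ η := by
    obtain ⟨θ, hθ⟩ := exists_ne θs
    exact (TopTwo.D1pair_le_sep _ _ hθ.symm hθ).trans
      (TopTwo.sep_le _ _ _ _ _ fun i => TopTwo.sq_mean_sub_mean_le hη hν i _ _)
  exact mul_le_mul_of_nonneg_left (TopTwo.bound_le_bound_pairConst
    (TopTwo.eta0_pos _ _ hne) hη hJ hδ (TopTwo.eta0_le_D1 _ _) hD hDη) (by norm_num)
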